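/- Let $K$ be a field and let $A$ be a weighted $\mathbb N$-filtered solvable polynomial algebra over $K$. That is: $A$ is an associative unital $K$-algebra with elements $a_1,\dots,a_n$ whose ordered monomials $a^\alpha=a_1^{\alpha_1}\cdots a_n^{\alpha_n}$ $(\alpha\in\mathbb N^n)$ form a $K$-basis; these monomials carry a monomial ordering $\prec$, i.e. a well-ordering such that, $\mathrm{LM}$ denoting the leading monomial, (a) $a^\alpha\prec a^\beta$ implies $\mathrm{LM}(a^\gamma a^\alpha a^\eta)\prec \mathrm{LM}(a^\gamma a^\beta a^\eta)$ whenever both leading monomials exist and are $\neq 1$, and (b) $a^\gamma=\mathrm{LM}(a^\alpha a^\beta a^\eta)$ and $\beta\ne\gamma$ imply $a^\beta\prec a^\gamma$; for all $\alpha,\beta$ one has $a^\alpha a^\beta=\lambda a^{\alpha+\beta}+f$ with $\lambda\in K\setminus\{0\}$ and $f=0$ or $\mathrm{LM}(f)\prec a^{\alpha+\beta}$; and there are positive integers $m_1,\dots,m_n$ such that the spaces $F_pA=K\text{-span}\{a^\alpha : \sum_i m_i\alpha_i\le p\}$ satisfy $F_pA\,F_qA\subseteq F_{p+q}A$ for all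 $p,q\in\mathbb N$. Modules are left modules. A filtered $A$-module is an $A$-module $M$ with $K$-subspaces $F_0M\subseteq F_1M\subseteq\cdots$ such that $\bigcup_q F_qM=M$ and $F_pA\,F_qM\subseteq F_{p+q}M$; submodules carry $F_qN=N\cap F_qM$ and quotients carry $F_q(M/N)=(F_qM+N)/N$. A filtered free module is $L=\bigoplus_{j=1}^sAe_j$ $(s\ge 0)$ with $F_qL=\bigoplus_j\big(\sum_{p+b_j\le q}F_pA\big)e_j$ for given $b_1,\dots,b_s\in\mathbb N$; call $e_1,\dots,e_s$ its basis. A homomorphism $\varphi:M\to M'$ is filtered if $\varphi(F_qM)\subseteq F_qM'$ for all $q$, and strict filtered if moreover $\varphi(F_qM)=\varphi(M)\cap F_qM'$ for all $q$. A finite family $(v_i)$ of nonzero elements of $M$ is an F-basis of $M$ if there are $k_i\in\mathbb N$ with $F_qM=\sum_i\big(\sum_{p+k_i\le q}F_pA\big)v_i$ for all $q$; it is a minimal F-basis if no proper subfamily is an F-basis. A minimal standard basis of a submodule $N\subseteq M$ is a minimal F-basis of $N$ for the induced filtration. With $F_{-1}=0$, put $G(A)=\bigoplus_pF_pA/F_{p-1}A$,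 $G(M)=\bigoplus_qF_qM/F_{q-1}M$ (the associated graded ring and module), and $\widetilde A=\bigoplus_pF_pA$, $\widetilde M=\bigoplus_qF_qM$ (the Rees ring and module). A filtered homomorphism $\varphi$ induces graded homomorphisms $G(\varphi)$ and $\widetilde\varphi$, linear over $G(A)$ and $\widetilde A$ respectively. Let $L_0$ be a filtered free $A$-module, $N\subseteq L_0$ a submodule, and $M=L_0/N$ with the quotient filtration. A minimal filtered free resolution $\mathcal L_\bullet$ of $M$ is an exact sequence of filtered homomorphisms $$\cdots\to L_{i+1}\xrightarrow{\varphi_{i+1}}L_i\to\cdots\to L_1\xrightarrow{\varphi_1}L_0\xrightarrow{\varphi_0}M\to0$$ in which $\varphi_0$ is the canonical map and sends the basis of $L_0$ to a minimal F-basis of $M$, and, for each $i\ge1$, $L_i$ is a filtered free module of finite rank and $\varphi_i$ is a strict filtered homomorphism that sends the basis of $L_i$ to a minimal standard basis of $\ker\varphi_{i-1}$ (images of bases being taken as families indexed by the basis). A minimal graded free resolution of a graded module over an $\mathbb N$-graded ring is an exact sequence of graded homomorphisms of degree $0$ between the module and graded free modules having finite homogeneous bases that are sent to minimal homogeneous generating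 sets of the module, respectively of the kernel of the preceding map (minimal: no proper subfamily generates). **Theorem 6.3.** Let $\mathcal L_\bullet$ be a minimal filtered free resolution of $M=L_0/N$. (i) $G(\mathcal L_\bullet):\ \cdots\to G(L_1)\xrightarrow{G(\varphi_1)}G(L_0)\xrightarrow{G(\varphi_0)}G(M)\to0$ is a minimal graded free resolution of the graded $G(A)$-module $G(M)$. (ii) $\widetilde{\mathcal L}_\bullet:\ \cdots\to\widetilde L_1\xrightarrow{\widetilde\varphi_1}\widetilde L_0\xrightarrow{\widetilde\varphi_0}\widetilde M\to0$ is a minimal graded free resolution of the graded $\widetilde A$-module $\widetilde M$. (iii) If $\mathcal L'_\bullet:\ \cdots\to L_2'\xrightarrow{\varphi_2'}L_1'\xrightarrow{\varphi_1'}L_0\xrightarrow{\varphi_0}M\to0$ is another minimal filtered free resolution of $M$ (with the same $L_0$, $N$), then there are $A$-module isomorphisms $\chi_i:L_i\to L_i'$ $(i\ge1)$ with $\chi_i(F_qL_i)=F_qL_i'$ for all $q\in\mathbb N$ such that, with $\chi_0=\mathrm{id}_{L_0}$, one has $\chi_{i-1}\varphi_i=\varphi_i'\chi_i$ for all $i\ge1$.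 -/

import Mathlib

open scoped DirectSum

noncomputable section

namespace FilteredRes

/-! ### Weighted filtered solvable polynomial algebras -/

/-- The ordered monomial `a₁^α₁ ⋯ aₙ^αₙ` (the factors multiplied in this order). -/
def pbwMonomial {A : Type*} [Ring A] {n : ℕ} (a : Fin n → A) (α : Fin n → ℕ) : A :=
  (List.ofFn fun i => a i ^ α i).prod

/-- `IsLM B lt f α` : with respect to the ordering `lt` of the exponents, the leading monomial
of `f` is the basis element `B α`. (It holds for no `α` when `f = 0`.) -/
def IsLM {K A : Type*} [Field K] [Ring A] [Algebra K A] {n : ℕ}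
    (B : Module.Basis (Fin n → ℕ) K A) (lt : (Fin n → ℕ) → (Fin n → ℕ) → Prop)
    (f : A) (α : Fin n → ℕ) : Prop :=
  α ∈ (B.repr f).support ∧ ∀ β ∈ (B.repr f).support, β ≠ α → lt β α

/-- A solvable polynomial algebra structure on the `K`-algebra `A`: generators `a₁, …, aₙ` whose
ordered monomials form a `K`-basis of `A`, and a monomial ordering on this basis for which
`a^α a^β` is a nonzero multiple of `a^(α+β)` plus smaller terms. The ordering of the basis is
recorded as an ordering `lt` of the exponents. -/
structure SolvablePolynomialAlgebra (K A : Type*) [Field K] [Ring A] [Algebra K A] (n : ℕ) where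
  /-- the generators -/
  gen : Fin n → A
  /-- the PBW basis -/
  pbw : Module.Basis (Fin n → ℕ) K A
  pbw_eq : ∀ α, pbw α = pbwMonomial gen α
  /-- the monomial ordering -/
  lt : (Fin n → ℕ) → (Fin n → ℕ) → Prop
  lt_wellOrder : IsWellOrder (Fin n → ℕ) lt
  lt_mul : ∀ γ α β η μ ν, lt α β →
    IsLM pbw lt (pbw γ * pbw α * pbw η) μ → IsLM pbw lt (pbw γ * pbw β * pbw η) ν →
    μ ≠ 0 → ν ≠ 0 → lt μ ν
  lt_of_factor : ∀ α β η γ, β ≠ γ → IsLM pbw lt (pbw α * pbw β * pbw η) γ → lt β γ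
  solvable : ∀ α β, ∃ c : K, c ≠ 0 ∧ ∃ f : A,
    pbw α * pbw β = c • pbw (α + β) + f ∧ ∀ γ, IsLM pbw lt f γ → lt γ (α + β)

/-- The degree `m₁α₁ + ⋯ + mₙαₙ` of a monomial, for the weights `m`. -/
def wdeg {n : ℕ} (m : Fin n → ℕ) (α : Fin n → ℕ) : ℕ := ∑ i, m i * α i

/-- A weighted `ℕ`-filtered solvable polynomial algebra: a solvable polynomial algebra with
positive weights of the generators such that the subspaces
`F_p A = K-span of the monomials of degree ≤ p` satisfy `F_p A · F_q A ⊆ F_{p+q} A`. -/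
structure WeightedFilteredSPA (K A : Type*) [Field K] [Ring A] [Algebra K A] (n : ℕ) extends
    SolvablePolynomialAlgebra K A n where
  /-- the degrees of the generators -/
  weight : Fin n → ℕ
  weight_pos : ∀ i, 0 < weight i
  mul_mem_span : ∀ p q : ℕ,
    ∀ f ∈ Submodule.span K {x | ∃ α, wdeg weight α ≤ p ∧ x = pbw α},
    ∀ g ∈ Submodule.span K {x | ∃ α, wdeg weight α ≤ q ∧ x = pbw α},
    f * g ∈ Submodule.span K {x | ∃ α, wdeg weight α ≤ p + q ∧ x = pbw α}

section

variable {K A : Type*} [Field K] [Ring A] [Algebra K A] {n : ℕ}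

/-- The filtration `F_p A` (a `K`-subspace, regarded as an additive subgroup). -/
def WeightedFilteredSPA.F (S : WeightedFilteredSPA K A n) (p : ℕ) : AddSubgroup A :=
  (Submodule.span K {x | ∃ α, wdeg S.weight α ≤ p ∧ x = S.pbw α}).toAddSubgroup

variable (S : WeightedFilteredSPA K A n)

theorem WeightedFilteredSPA.mono : Monotone S.F := by
  intro p q h x hx
  refine Submodule.span_mono ?_ hx
  rintro y ⟨α, hα, rfl⟩
  exact ⟨α, hα.trans h, rfl⟩

theorem WeightedFilteredSPA.one_mem : (1 : A) ∈ S.F 0 := by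
  refine Submodule.subset_span ⟨0, by simp [wdeg], ?_⟩
  simp [S.pbw_eq, pbwMonomial]

theorem WeightedFilteredSPA.exhaust (x : A) : ∃ p, x ∈ S.F p := by
  have hx : x ∈ Submodule.span K (Set.range S.pbw) := by rw [S.pbw.span_eq]; trivial
  induction hx using Submodule.span_induction with
  | mem y hy =>
    obtain ⟨α, rfl⟩ := hy
    exact ⟨wdeg S.weight α, Submodule.subset_span ⟨α, le_rfl, rfl⟩⟩
  | zero => exact ⟨0, zero_mem _⟩
  | add y z _ _ hy hz =>
    obtain ⟨p, hp⟩ := hy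
    obtain ⟨q, hq⟩ := hz
    exact ⟨max p q, add_mem (S.mono (le_max_left p q) hp) (S.mono (le_max_right p q) hq)⟩
  | smul c y _ hy =>
    obtain ⟨p, hp⟩ := hy
    exact ⟨p, Submodule.smul_mem _ c hp⟩

instance : SetLike.GradedMonoid S.F where
  one_mem := S.one_mem
  mul_mem {p q f g} hf hg := S.mul_mem_span p q f hf g hg

/-! ### Filtered modules -/

/-- An `ℕ`-filtration of the left `A`-module `M`: an increasing exhaustive chain of additive
subgroups with `F_p A · F_q M ⊆ F_{p+q} M`. As `K · 1 ⊆ F_0 A`, the `F_q M` are automatically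
`K`-subspaces. -/
structure Filtration (S : WeightedFilteredSPA K A n) (M : Type*) [AddCommGroup M]
    [Module A M] where
  /-- the filtration subgroups -/
  F : ℕ → AddSubgroup M
  mono : Monotone F
  exhaust : ∀ x, ∃ q, x ∈ F q
  smul_mem : ∀ p q (a : A) (x : M), a ∈ S.F p → x ∈ F q → a • x ∈ F (p + q)

/-- The filtration of `A` as a left module over itself. -/
def WeightedFilteredSPA.self : Filtration S A where
  F := S.F
  mono := S.mono
  exhaust := S.exhaust
  smul_mem _ _ _ _ ha hx := SetLike.mul_mem_graded ha hx

variable {S} {M : Type*} [AddCommGroup M] [Module A M]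
variable {M' : Type*} [AddCommGroup M'] [Module A M']

instance (FM : Filtration S M) : SetLike.GradedSMul S.F FM.F where
  smul_mem {p q a x} ha hx := FM.smul_mem p q a x ha hx

/-- The filtration `F_q N = N ∩ F_q M` induced on a submodule `N` of `M`. -/
def Filtration.sub (FM : Filtration S M) (N : Submodule A M) : Filtration S N where
  F q := (FM.F q).comap N.subtype.toAddMonoidHom
  mono _ _ h _ hx := FM.mono h hx
  exhaust x := FM.exhaust x.1
  smul_mem p q a x ha hx := FM.smul_mem p q a x.1 ha hx

/-- The filtration `F_q (M/N) = (F_q M + N)/N` induced on a quotient of `M`. -/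
def Filtration.quot (FM : Filtration S M) (N : Submodule A M) : Filtration S (M ⧸ N) where
  F q := (FM.F q).map N.mkQ.toAddMonoidHom
  mono _ _ h := AddSubgroup.map_mono (FM.mono h)
  exhaust x := by
    obtain ⟨y, rfl⟩ := N.mkQ_surjective x
    obtain ⟨q, hq⟩ := FM.exhaust y
    exact ⟨q, y, hq, rfl⟩
  smul_mem p q a x ha hx := by
    obtain ⟨y, hy, rfl⟩ := hx
    exact ⟨a • y, FM.smul_mem p q a y ha hy, map_smul N.mkQ a y⟩

/-- A filtered homomorphism: `φ (F_q M) ⊆ F_q M'`. -/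
def IsFilteredHom (FM : Filtration S M) (FM' : Filtration S M') (φ : M →ₗ[A] M') : Prop :=
  ∀ q, ∀ x ∈ FM.F q, φ x ∈ FM'.F q

/-- A strict filtered homomorphism: `φ (F_q M) = φ (M) ∩ F_q M'`. -/
def IsStrictHom (FM : Filtration S M) (FM' : Filtration S M') (φ : M →ₗ[A] M') : Prop :=
  ∀ q, φ '' (FM.F q : Set M) = Set.range φ ∩ (FM'.F q : Set M')

theorem isFilteredHom_mkQ (FM : Filtration S M) (N : Submodule A M) :
    IsFilteredHom FM (FM.quot N) N.mkQ :=
  fun _ x hx => ⟨x, hx, rfl⟩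

/-- `∑_{p + b ≤ q} F_p A`, which is `F_{q-b} A` for `b ≤ q` and zero otherwise. -/
def WeightedFilteredSPA.shift (S : WeightedFilteredSPA K A n) (b q : ℕ) : AddSubgroup A :=
  if b ≤ q then S.F (q - b) else ⊥

/-- The finite family `v` of nonzero elements is an F-basis of the filtered module `M`: there are
`k i ∈ ℕ` with `F_q M = ∑ i, (∑_{p + k i ≤ q} F_p A) v i` for all `q`. -/
def IsFBasis (FM : Filtration S M) {ι : Type*} [Fintype ι] (v : ι → M) : Prop :=
  (∀ i, v i ≠ 0) ∧ ∃ k : ι → ℕ, ∀ q x,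
    x ∈ FM.F q ↔ ∃ c : ι → A, (∀ i, c i ∈ S.shift (k i) q) ∧ x = ∑ i, c i • v i

/-- A minimal F-basis: an F-basis such that no proper subfamily is an F-basis. (The members
of a minimal F-basis are therefore pairwise distinct.) -/
def IsMinimalFBasis (FM : Filtration S M) {ι : Type*} [Fintype ι] (v : ι → M) : Prop :=
  IsFBasis FM v ∧ ∀ T : Finset ι, T ≠ Finset.univ → ¬ IsFBasis FM (fun i : T => v i)

/-- A minimal standard basis of the submodule `N` of `M`: a family of elements of `N` that is a
minimal F-basis of `N` with respect to the induced filtration. -/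
def IsMinimalStandardBasis (FM : Filtration S M) (N : Submodule A M) {ι : Type*} [Fintype ι]
    (v : ι → M) : Prop :=
  ∃ h : ∀ i, v i ∈ N, IsMinimalFBasis (FM.sub N) (fun i => (⟨v i, h i⟩ : N))

/-! ### The associated graded ring and modules -/

/-- `F_{q-1}`, with `F_{-1} = 0`. -/
def below (F : ℕ → AddSubgroup M) : ℕ → AddSubgroup M
  | 0 => ⊥
  | q + 1 => F q

/-- The quotient `F_q / F_{q-1}`, with `F_{-1} = 0`. -/
def GrPiece (F : ℕ → AddSubgroup M) (q : ℕ) : Type _ :=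
  F q ⧸ (below F q).addSubgroupOf (F q)

instance (F : ℕ → AddSubgroup M) (q : ℕ) : AddCommGroup (GrPiece F q) :=
  inferInstanceAs (AddCommGroup (F q ⧸ (below F q).addSubgroupOf (F q)))

/-- The class of `x ∈ F_q` in `F_q / F_{q-1}`. -/
def grMk (F : ℕ → AddSubgroup M) (q : ℕ) : F q →+ GrPiece F q :=
  QuotientAddGroup.mk' ((below F q).addSubgroupOf (F q))

theorem grMk_surjective (F : ℕ → AddSubgroup M) (q : ℕ) : Function.Surjective (grMk F q) :=
  QuotientAddGroup.mk'_surjective _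

theorem mk_grMk_congr (F : ℕ → AddSubgroup M) {p q : ℕ} (h : p = q) (x : F p) (y : F q)
    (hxy : (x : M) = y) :
    GradedMonoid.mk (A := GrPiece F) p (grMk F p x) = GradedMonoid.mk q (grMk F q y) := by
  subst h
  rw [Subtype.ext hxy]

theorem smul_mem_below_right (FM : Filtration S M) {p q : ℕ} {a : A} {x : M}
    (ha : a ∈ S.F p) (hx : x ∈ below FM.F q) : a • x ∈ below FM.F (p + q) := by
  cases q with
  | zero =>
    have : x = 0 := hx
    rw [this, smul_zero]
    exact zero_mem _
  | succ q => exact FM.smul_mem p q a x ha hx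

theorem smul_mem_below_left (FM : Filtration S M) {p q : ℕ} {a : A} {x : M}
    (ha : a ∈ below S.F p) (hx : x ∈ FM.F q) : a • x ∈ below FM.F (p + q) := by
  cases p with
  | zero =>
    have : a = 0 := ha
    rw [this, zero_smul]
    exact zero_mem _
  | succ p =>
    rw [Nat.succ_add]
    exact FM.smul_mem p q a x ha hx

/-- The product of `a ∈ F_p A` and `x ∈ F_q M`, as an element of `F_{p+q} M`. -/
def Filtration.smulF (FM : Filtration S M) {p q : ℕ} (a : S.F p) (x : FM.F q) : FM.F (p + q) :=
  ⟨(a : A) • (x : M), FM.smul_mem p q a x a.2 x.2⟩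

/-- The product `(a + F_{p-1} A) · (x + F_{q-1} M) = a x + F_{p+q-1} M`. -/
def grSmul (FM : Filtration S M) {p q : ℕ} :
    GrPiece S.F p → GrPiece FM.F q → GrPiece FM.F (p + q) :=
  Quotient.map₂ FM.smulF <| by
    intro a a' ha x x' hx
    have ha' : -(a : A) + a' ∈ below S.F p := 
      (QuotientAddGroup.leftRel_apply (s := (below S.F p).addSubgroupOf (S.F p))).1 ha
    have hx' : -(x : M) + x' ∈ below FM.F q := 
      (QuotientAddGroup.leftRel_apply (s := (below FM.F q).addSubgroupOf (FM.F q))).1 hx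
    refine QuotientAddGroup.leftRel_apply.2 ?_
    change -((a : A) • (x : M)) + (a' : A) • (x' : M) ∈ below FM.F (p + q)
    have h := add_mem (smul_mem_below_right FM a.2 hx') (smul_mem_below_left FM ha' x'.2)
    have e : -((a : A) • (x : M)) + (a' : A) • (x' : M)
        = (a : A) • (-(x : M) + x') + (-(a : A) + a') • (x' : M) := by
      rw [smul_add, add_smul, smul_neg, neg_smul]
      abel
    rw [e]
    exact h

theorem grSmul_mk (FM : Filtration S M) {p q : ℕ} (a : S.F p) (x : FM.F q) :
    grSmul FM (grMk S.F p a) (grMk FM.F q x) = grMk FM.F (p + q) (FM.smulF a x) := rfl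

theorem grSmul_add (FM : Filtration S M) {p q : ℕ} (a : GrPiece S.F p) (x y : GrPiece FM.F q) :
    grSmul FM a (x + y) = grSmul FM a x + grSmul FM a y := by
  obtain ⟨a, rfl⟩ := grMk_surjective _ _ a
  obtain ⟨x, rfl⟩ := grMk_surjective _ _ x
  obtain ⟨y, rfl⟩ := grMk_surjective _ _ y
  rw [← map_add, grSmul_mk, grSmul_mk, grSmul_mk, ← map_add]
  exact congrArg _ (Subtype.ext (smul_add (a : A) (x : M) (y : M)))

theorem add_grSmul (FM : Filtration S M) {p q : ℕ} (a b : GrPiece S.F p) (x : GrPiece FM.F q) :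
    grSmul FM (a + b) x = grSmul FM a x + grSmul FM b x := by
  obtain ⟨a, rfl⟩ := grMk_surjective _ _ a
  obtain ⟨b, rfl⟩ := grMk_surjective _ _ b
  obtain ⟨x, rfl⟩ := grMk_surjective _ _ x
  rw [← map_add, grSmul_mk, grSmul_mk, grSmul_mk, ← map_add]
  exact congrArg _ (Subtype.ext (add_smul (a : A) (b : A) (x : M)))

theorem grSmul_zero (FM : Filtration S M) {p q : ℕ} (a : GrPiece S.F p) :
    grSmul FM a (0 : GrPiece FM.F q) = 0 := by
  have h := grSmul_add FM a (0 : GrPiece FM.F q) 0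
  rwa [add_zero, left_eq_add] at h

theorem zero_grSmul (FM : Filtration S M) {p q : ℕ} (x : GrPiece FM.F q) :
    grSmul FM (0 : GrPiece S.F p) x = 0 := by
  have h := add_grSmul FM (0 : GrPiece S.F p) 0 x
  rwa [add_zero, left_eq_add] at h

theorem one_grSmul (FM : Filtration S M) {q : ℕ} (x : GrPiece FM.F q) :
    GradedMonoid.mk (A := GrPiece FM.F) (0 + q) (grSmul FM (grMk S.F 0 ⟨1, S.one_mem⟩) x)
      = GradedMonoid.mk q x := by
  obtain ⟨x, rfl⟩ := grMk_surjective _ _ x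
  exact mk_grMk_congr _ (zero_add q) _ _ (one_smul A (x : M))

theorem mul_grSmul (FM : Filtration S M) {p q r : ℕ} (a : GrPiece S.F p) (b : GrPiece S.F q)
    (x : GrPiece FM.F r) :
    GradedMonoid.mk (A := GrPiece FM.F) (p + q + r)
        (grSmul FM (grSmul (S := S) S.self a b : GrPiece S.F (p + q)) x)
      = GradedMonoid.mk (p + (q + r)) (grSmul FM a (grSmul FM b x)) := by
  obtain ⟨a, rfl⟩ := grMk_surjective _ _ a
  obtain ⟨b, rfl⟩ := grMk_surjective _ _ b
  obtain ⟨x, rfl⟩ := grMk_surjective _ _ x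
  exact mk_grMk_congr _ (add_assoc p q r) _ _ (mul_smul (a : A) (b : A) (x : M))

instance (S : WeightedFilteredSPA K A n) : GradedMonoid.GMul (GrPiece S.F) where
  mul a b := grSmul S.self a b

instance (S : WeightedFilteredSPA K A n) : GradedMonoid.GOne (GrPiece S.F) where
  one := grMk S.F 0 ⟨1, S.one_mem⟩

instance (S : WeightedFilteredSPA K A n) : GradedMonoid.GMonoid (GrPiece S.F) where
  one_mul a := one_grSmul S.self a.2
  mul_one a := by
    obtain ⟨p, a⟩ := a
    obtain ⟨a, rfl⟩ := grMk_surjective _ _ a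
    exact mk_grMk_congr _ (add_zero p) _ _ (mul_one (a : A))
  mul_assoc a b c := mul_grSmul S.self a.2 b.2 c.2

/-- The graded ring structure on the pieces `F_p A / F_{p-1} A`, with the multiplication
`(a + F_{p-1} A) (b + F_{q-1} A) = a b + F_{p+q-1} A`. -/
instance (S : WeightedFilteredSPA K A n) : DirectSum.GRing (GrPiece S.F) where
  toGMonoid := inferInstance
  mul_zero a := grSmul_zero S.self a
  zero_mul b := zero_grSmul S.self b
  mul_add a b c := grSmul_add S.self a b c
  add_mul a b c := add_grSmul S.self a b c
  natCast k := k • grMk S.F 0 ⟨1, S.one_mem⟩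
  natCast_zero := zero_nsmul _
  natCast_succ k := succ_nsmul _ k
  intCast z := z • grMk S.F 0 ⟨1, S.one_mem⟩
  intCast_ofNat k := natCast_zsmul _ k
  intCast_negSucc_ofNat k := negSucc_zsmul _ k

/-- The graded module structure on the pieces `F_q M / F_{q-1} M`. -/
instance (FM : Filtration S M) : DirectSum.Gmodule (GrPiece S.F) (GrPiece FM.F) where
  smul a x := grSmul FM a x
  one_smul x := one_grSmul FM x.2
  mul_smul a b x := mul_grSmul FM a.2 b.2 x.2
  smul_add a x y := grSmul_add FM a x y
  smul_zero a := grSmul_zero FM a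
  add_smul a b x := add_grSmul FM a b x
  zero_smul x := zero_grSmul FM x

/-- The associated graded ring `G(A) = ⨁ F_p A / F_{p-1} A`. -/
abbrev GrRing (S : WeightedFilteredSPA K A n) : Type _ := ⨁ p, GrPiece S.F p

/-- The associated graded `G(A)`-module `G(M) = ⨁ F_q M / F_{q-1} M`. -/
abbrev GrModule (FM : Filtration S M) : Type _ := ⨁ q, GrPiece FM.F q

/-- The Rees ring `⨁ F_p A`. -/
abbrev ReesRing (S : WeightedFilteredSPA K A n) : Type _ := ⨁ p, S.F p

/-- The Rees module `⨁ F_q M`, a module over the Rees ring. -/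
abbrev ReesModule (FM : Filtration S M) : Type _ := ⨁ q, FM.F q


theorem IsFilteredHom.below {FM : Filtration S M} {FM' : Filtration S M'} {φ : M →ₗ[A] M'}
    (h : IsFilteredHom FM FM' φ) (q : ℕ) {x : M} (hx : x ∈ below FM.F q) :
    φ x ∈ below FM'.F q := by
  cases q with
  | zero =>
    have : x = 0 := hx
    rw [this, map_zero]
    exact zero_mem _
  | succ q => exact h q x hx

/-- The restriction `F_q M → F_q M'` of a filtered homomorphism. -/
def IsFilteredHom.restrict {FM : Filtration S M} {FM' : Filtration S M'} {φ : M →ₗ[A] M'}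
    (h : IsFilteredHom FM FM' φ) (q : ℕ) : FM.F q →+ FM'.F q :=
  (φ.toAddMonoidHom.comp (FM.F q).subtype).codRestrict _ fun x => h q x x.2

/-- The map `x + F_{q-1} M ↦ φ x + F_{q-1} M'`. -/
def IsFilteredHom.grPiece {FM : Filtration S M} {FM' : Filtration S M'} {φ : M →ₗ[A] M'}
    (h : IsFilteredHom FM FM' φ) (q : ℕ) : GrPiece FM.F q →+ GrPiece FM'.F q :=
  QuotientAddGroup.map _ _ (h.restrict q) fun _ hx => h.below q hx

theorem IsFilteredHom.grPiece_mk {FM : Filtration S M} {FM' : Filtration S M'} {φ : M →ₗ[A] M'}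
    (h : IsFilteredHom FM FM' φ) (q : ℕ) (x : FM.F q) :
    h.grPiece q (grMk FM.F q x) = grMk FM'.F q (h.restrict q x) := rfl

/-- A family of additive maps between the pieces of two graded modules that commutes with the
action of homogeneous elements gives a linear map of the direct sums. -/
def gradedLinearMap {𝒜 ℳ 𝒩 : ℕ → Type*} [∀ p, AddCommGroup (𝒜 p)] [DirectSum.GRing 𝒜]
    [∀ q, AddCommGroup (ℳ q)] [DirectSum.Gmodule 𝒜 ℳ]
    [∀ q, AddCommGroup (𝒩 q)] [DirectSum.Gmodule 𝒜 𝒩] (f : ∀ q, ℳ q →+ 𝒩 q)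
    (hf : ∀ (p q : ℕ) (a : 𝒜 p) (x : ℳ q),
      f (p +ᵥ q) (GradedMonoid.GSMul.smul a x) = GradedMonoid.GSMul.smul a (f q x)) :
    (⨁ q, ℳ q) →ₗ[⨁ p, 𝒜 p] (⨁ q, 𝒩 q) where
  toFun := DirectSum.map f
  map_add' := map_add _
  map_smul' a x := by
    rw [RingHom.id_apply]
    induction a using DirectSum.induction_on with
    | zero => rw [zero_smul, zero_smul, map_zero]
    | add a b ha hb => rw [add_smul, add_smul, map_add, ha, hb]
    | of p a =>
      induction x using DirectSum.induction_on with
      | zero => rw [map_zero, smul_zero, smul_zero, map_zero]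
      | add x y hx hy => rw [map_add, smul_add, smul_add, map_add, hx, hy]
      | of q x =>
        rw [DirectSum.map_of, DirectSum.Gmodule.of_smul_of, DirectSum.Gmodule.of_smul_of,
          DirectSum.map_of, hf]

/-- The graded homomorphism `G(φ) : G(M) → G(M')` of a filtered homomorphism `φ`. -/
def IsFilteredHom.gr {FM : Filtration S M} {FM' : Filtration S M'} {φ : M →ₗ[A] M'}
    (h : IsFilteredHom FM FM' φ) : GrModule FM →ₗ[GrRing S] GrModule FM' :=
  gradedLinearMap h.grPiece <| by
    intro p q a x
    obtain ⟨a, rfl⟩ := grMk_surjective _ _ a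
    obtain ⟨x, rfl⟩ := grMk_surjective _ _ x
    exact congrArg (grMk FM'.F (p + q)) (Subtype.ext (map_smul φ (a : A) (x : M)))

/-- The graded homomorphism of Rees modules induced by a filtered homomorphism `φ`. -/
def IsFilteredHom.rees {FM : Filtration S M} {FM' : Filtration S M'} {φ : M →ₗ[A] M'}
    (h : IsFilteredHom FM FM' φ) : ReesModule FM →ₗ[ReesRing S] ReesModule FM' :=
  gradedLinearMap h.restrict <| by
    intro p q a x
    exact Subtype.ext (map_smul φ (a : A) (x : M))

end

/-! ### Minimal graded free resolutions -/

section

variable {𝒜 : ℕ → Type*} [∀ p, AddCommGroup (𝒜 p)] [DirectSum.GRing 𝒜]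
variable {ℳ : ℕ → Type*} [∀ q, AddCommGroup (ℳ q)] [DirectSum.Gmodule 𝒜 ℳ]
variable {𝒩 : ℕ → Type*} [∀ q, AddCommGroup (𝒩 q)] [DirectSum.Gmodule 𝒜 𝒩]

/-- Homogeneous elements of a graded module. -/
def IsHomogeneousElt (x : ⨁ q, ℳ q) : Prop := ∃ q, ∃ y : ℳ q, x = DirectSum.of ℳ q y

/-- Graded homomorphisms (of degree zero): `f` maps the piece of degree `q` to the piece of
degree `q`. -/
def IsGradedHom (f : (⨁ q, ℳ q) →ₗ[⨁ p, 𝒜 p] (⨁ q, 𝒩 q)) : Prop :=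
  ∀ q, ∀ x : ℳ q, ∃ y : 𝒩 q, f (DirectSum.of ℳ q x) = DirectSum.of 𝒩 q y

/-- The family `v` is a minimal homogeneous generating set of the submodule `P`: its members are
homogeneous, it generates `P`, and no proper subfamily generates `P`. -/
def IsMinimalHomogeneousGenerators (P : Submodule (⨁ p, 𝒜 p) (⨁ q, ℳ q)) {ι : Type*}
    (v : ι → ⨁ q, ℳ q) : Prop :=
  (∀ i, IsHomogeneousElt (v i)) ∧ Submodule.span (⨁ p, 𝒜 p) (Set.range v) = P ∧
    ∀ T : Set ι, T ≠ Set.univ → Submodule.span (⨁ p, 𝒜 p) (v '' T) ≠ P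

/-- `⋯ → L 1 → L 0 → M → 0`, with maps `d i : L (i+1) → L i` and `ε : L 0 → M`, is a minimal
graded free resolution of the graded module `M`: the maps are graded, the sequence is exact, and
the `L i` have finite homogeneous bases that are mapped to minimal homogeneous generating
sets of `M` (for `i = 0`), respectively of the kernel of the preceding map. -/
structure IsMinimalGradedFreeResolution {ℒ : ℕ → ℕ → Type*} [∀ i q, AddCommGroup (ℒ i q)]
    [∀ i, DirectSum.Gmodule 𝒜 (ℒ i)]
    (d : ∀ i, DirectSum ℕ (ℒ (i + 1)) →ₗ[⨁ p, 𝒜 p] DirectSum ℕ (ℒ i))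
    (ε : DirectSum ℕ (ℒ 0) →ₗ[⨁ p, 𝒜 p] (⨁ q, ℳ q)) : Prop where
  graded_aug : IsGradedHom ε
  graded : ∀ i, IsGradedHom (d i)
  surjective_aug : Function.Surjective ε
  exact_aug : Function.Exact (d 0) ε
  exact : ∀ i, Function.Exact (d (i + 1)) (d i)
  minimal : ∃ (r : ℕ → ℕ) (e : ∀ i, Module.Basis (Fin (r i)) (⨁ p, 𝒜 p) (⨁ q, ℒ i q)),
    (∀ i j, IsHomogeneousElt (e i j)) ∧
    IsMinimalHomogeneousGenerators (⊤ : Submodule (⨁ p, 𝒜 p) (⨁ q, ℳ q)) (fun j => ε (e 0 j)) ∧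
    IsMinimalHomogeneousGenerators (LinearMap.ker ε) (fun j => d 0 (e 1 j)) ∧
    ∀ i, IsMinimalHomogeneousGenerators (LinearMap.ker (d i)) (fun j => d (i + 1) (e (i + 2) j))

end

/-! ### Minimal filtered free resolutions -/

/-- The data `(s; b₁, …, b_s)` of a filtered free module `A e₁ ⊕ ⋯ ⊕ A e_s`, in which `e_j` has
the filtered degree `b_j`. -/
structure FreeDatum where
  /-- the rank `s` -/
  rank : ℕ
  /-- the filtered degrees `b_j` of the basis elements -/
  deg : Fin rank → ℕ

/-- The free module with the standard basis. -/
abbrev FreeDatum.Mod (A : Type*) (D : FreeDatum) : Type _ := Fin D.rank → A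

/-- The basis element `e_j`. -/
def FreeDatum.e (A : Type*) [Ring A] (D : FreeDatum) (j : Fin D.rank) : D.Mod A :=
  Pi.single j 1

section

variable {K A : Type*} [Field K] [Ring A] [Algebra K A] {n : ℕ}

theorem WeightedFilteredSPA.shift_mono (S : WeightedFilteredSPA K A n) (b : ℕ) {p q : ℕ}
    (h : p ≤ q) : S.shift b p ≤ S.shift b q := by
  unfold WeightedFilteredSPA.shift
  split_ifs with h₁ h₂
  · exact S.mono (Nat.sub_le_sub_right h b)
  · exact absurd (h₁.trans h) h₂
  · exact bot_le
  · exact le_rfl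

theorem WeightedFilteredSPA.mem_shift_add (S : WeightedFilteredSPA K A n) (b p : ℕ) (x : A)
    (hx : x ∈ S.F p) : x ∈ S.shift b (p + b) := by
  unfold WeightedFilteredSPA.shift
  rw [if_pos (Nat.le_add_left b p), Nat.add_sub_cancel]
  exact hx

theorem WeightedFilteredSPA.mul_mem_shift (S : WeightedFilteredSPA K A n) (b p q : ℕ) (a x : A)
    (ha : a ∈ S.F p) (hx : x ∈ S.shift b q) : a * x ∈ S.shift b (p + q) := by
  unfold WeightedFilteredSPA.shift at hx ⊢
  split_ifs at hx with h
  · rw [if_pos (h.trans (Nat.le_add_left q p)), Nat.add_sub_assoc h]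
    exact SetLike.mul_mem_graded ha hx
  · have : x = 0 := hx
    rw [this, mul_zero]
    exact zero_mem _

/-- The filtration `F_q L = ⨁ j, (∑_{p + b_j ≤ q} F_p A) e_j` of a filtered free module. -/
def FreeDatum.fil (S : WeightedFilteredSPA K A n) (D : FreeDatum) : Filtration S (D.Mod A) where
  F q := AddSubgroup.pi Set.univ fun j => S.shift (D.deg j) q
  mono _ _ h _ hx j hj := S.shift_mono (D.deg j) h (hx j hj)
  exhaust x := by
    choose p hp using fun j => S.exhaust (x j)
    refine ⟨∑ j, (p j + D.deg j), fun j _ => S.shift_mono _ ?_ (S.mem_shift_add _ _ _ (hp j))⟩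
    exact Finset.single_le_sum (f := fun j => p j + D.deg j) (fun _ _ => Nat.zero_le _)
      (Finset.mem_univ j)
  smul_mem p q a x ha hx j hj := S.mul_mem_shift _ _ _ _ _ ha (hx j hj)

/-- The sequence `L₀, L₁, L₂, …` with first term `L₀`. -/
abbrev FreeDatum.cons (L₀ : FreeDatum) (L : ℕ → FreeDatum) : ℕ → FreeDatum
  | 0 => L₀
  | i + 1 => L i

/-- A minimal filtered free resolution `⋯ → L₂ → L₁ → L₀ → M → 0` of `M = L₀/N`, where `L₀` is a
filtered free module and `M` has the induced filtration. The map `L₀ → M` is the canonical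
one, and maps the basis of `L₀` to a minimal F-basis of `M`; the maps `d i : L_{i+1} → L_i` are
strict filtered homomorphisms of filtered free modules that map the basis of `L_{i+1}` to a minimal
standard basis of the kernel of the preceding map. -/
structure MinimalFilteredFreeResolution (S : WeightedFilteredSPA K A n) (L₀ : FreeDatum)
    (N : Submodule A (L₀.Mod A)) where
  /-- the filtered free modules `L₁, L₂, …` -/
  tail : ℕ → FreeDatum
  /-- the maps `L_{i+1} → L_i` -/
  d : ∀ i, (L₀.cons tail (i + 1)).Mod A →ₗ[A] (L₀.cons tail i).Mod A
  filtered : ∀ i, IsFilteredHom ((L₀.cons tail (i + 1)).fil S) ((L₀.cons tail i).fil S) (d i)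
  strict : ∀ i, IsStrictHom ((L₀.cons tail (i + 1)).fil S) ((L₀.cons tail i).fil S) (d i)
  exact_aug : Function.Exact (d 0) N.mkQ
  exact : ∀ i, Function.Exact (d (i + 1)) (d i)
  minimal_aug : IsMinimalFBasis ((L₀.fil S).quot N) (fun j => N.mkQ (L₀.e A j))
  minimal_zero : IsMinimalStandardBasis (L₀.fil S) (LinearMap.ker N.mkQ)
    (fun j => d 0 ((tail 0).e A j))
  minimal : ∀ i, IsMinimalStandardBasis ((L₀.cons tail (i + 1)).fil S) (LinearMap.ker (d i))
    (fun j => d (i + 1) ((tail (i + 1)).e A j))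

variable {S : WeightedFilteredSPA K A n} {L₀ : FreeDatum} {N : Submodule A (L₀.Mod A)}

/-- The filtered free modules `L₀, L₁, L₂, …` of a resolution. -/
abbrev MinimalFilteredFreeResolution.obj (L : MinimalFilteredFreeResolution S L₀ N) :
    ℕ → FreeDatum :=
  L₀.cons L.tail

end

end FilteredRes

end

/-! The proof is a filtered form of Nakayama's argument. Positive weights force `F_0 A = K`, so a
nonzero coefficient in filtered degree zero is invertible. If a syzygy in `F_{b_j} L` had a nonzero
coordinate at `e_j`, that coordinate would be a scalar, and one could solve for the `j`-th generator
without leaving the filtration, against minimality. This property of the kernel is `IsMinimalHom`,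
and it is the only form in which minimality enters afterwards.

For uniqueness, strictness lets filtered free modules lift maps. Lifts in both directions compose to
filtered endomorphisms `θ` over the base. The difference `θ - id` maps into the kernel, so by
`IsMinimalHom` it strictly lowers the largest degree of a basis element that occurs. Hence `θ` is
bijective on every filtration step (`IsMinimalHom.endomorphism_bijective`), and isomorphisms are
built one level at a time.

For `G` and the Rees construction, the pieces are `F_q` modulo `F_{q-1}` or modulo zero, so one
argument serves both. Strictness turns exactness of the filtered sequence into exactness of the
graded one (`Induces.exact`), and the basis of `L` gives a homogeneous basis. `IsMinimalHom` says
that coordinates of kernel elements have no degree-zero component (`Induces.repr_apply_zero`).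
Dropping a generator would produce a kernel element with coordinate `-1`, which is impossible. -/

noncomputable section

namespace FilteredRes

/-! ### Scalars in filtered degree zero, and coordinates in filtered free modules. -/

section

variable {K A : Type*} [Field K] [Ring A] [Algebra K A] {n : ℕ} {S : WeightedFilteredSPA K A n}
variable {M : Type*} [AddCommGroup M] [Module A M]
variable {M' : Type*} [AddCommGroup M'] [Module A M']

/-- With positive weights the only monomial of degree zero is `1`, so `F_0 A = K`. This supplies the
inverses that make redundant generators removable. -/
theorem WeightedFilteredSPA.exists_eq_algebraMap (S : WeightedFilteredSPA K A n) {x : A}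
    (hx : x ∈ S.F 0) : ∃ c : K, x = algebraMap K A c := by
  have h : x ∈ Submodule.span K {(1 : A)} := by
    refine Submodule.span_mono ?_ hx
    rintro y ⟨α, hα, rfl⟩
    have : α = 0 := by
      funext i
      have h0 : ∑ i, S.weight i * α i = 0 := Nat.le_zero.1 hα
      have h1 := (Finset.sum_eq_zero_iff.1 h0) i (Finset.mem_univ i)
      rcases Nat.mul_eq_zero.1 h1 with h | h
      · exact absurd h (S.weight_pos i).ne'
      · exact h
    subst this
    simp [S.pbw_eq, pbwMonomial]
  obtain ⟨c, rfl⟩ := Submodule.mem_span_singleton.1 h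
  exact ⟨c, (Algebra.algebraMap_eq_smul_one c).symm⟩

theorem WeightedFilteredSPA.algebraMap_mem (S : WeightedFilteredSPA K A n) (c : K) :
    algebraMap K A c ∈ S.F 0 := by
  rw [Algebra.algebraMap_eq_smul_one]
  exact Submodule.smul_mem _ c S.one_mem

theorem WeightedFilteredSPA.nontrivial (S : WeightedFilteredSPA K A n) : Nontrivial A :=
  ⟨⟨S.pbw 0, 0, S.pbw.ne_zero 0⟩⟩

theorem WeightedFilteredSPA.mem_shift_iff (S : WeightedFilteredSPA K A n) {b p q : ℕ}
    (h : p + b = q) {x : A} : x ∈ S.shift b q ↔ x ∈ S.F p := by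
  subst h
  rw [WeightedFilteredSPA.shift, if_pos (Nat.le_add_left b p), Nat.add_sub_cancel]

theorem WeightedFilteredSPA.eq_zero_of_mem_shift (S : WeightedFilteredSPA K A n) {b q : ℕ}
    (h : q < b) {x : A} (hx : x ∈ S.shift b q) : x = 0 := by
  rw [WeightedFilteredSPA.shift, if_neg (Nat.not_le.2 h)] at hx
  exact hx

theorem Filtration.smul_mem_of_mem_shift (FM : Filtration S M) {b q : ℕ} {a : A} {x : M}
    (ha : a ∈ S.shift b q) (hx : x ∈ FM.F b) : a • x ∈ FM.F q := by
  rcases lt_or_ge q b with h | h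
  · rw [S.eq_zero_of_mem_shift h ha, zero_smul]
    exact zero_mem _
  · obtain ⟨p, rfl⟩ := Nat.exists_eq_add_of_le' h
    exact FM.smul_mem p b a x ((S.mem_shift_iff rfl).1 ha) hx

theorem WeightedFilteredSPA.mul_mem_shift_of_mem_shift (S : WeightedFilteredSPA K A n)
    {b c q : ℕ} {a x : A} (ha : a ∈ S.shift b q) (hx : x ∈ S.shift c b) : a * x ∈ S.shift c q := by
  rcases lt_or_ge q b with h | h
  · rw [S.eq_zero_of_mem_shift h ha, zero_mul]
    exact zero_mem _
  · obtain ⟨p, rfl⟩ := Nat.exists_eq_add_of_le' h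
    exact S.mul_mem_shift c p b a x ((S.mem_shift_iff rfl).1 ha) hx

theorem FreeDatum.mem_fil {D : FreeDatum} {q : ℕ} {x : D.Mod A} :
    x ∈ (D.fil S).F q ↔ ∀ j, x j ∈ S.shift (D.deg j) q :=
  ⟨fun h j => h j (Set.mem_univ j), fun h j _ => h j⟩

theorem FreeDatum.e_mem (S : WeightedFilteredSPA K A n) (D : FreeDatum) (j : Fin D.rank) :
    D.e A j ∈ (D.fil S).F (D.deg j) := by
  refine FreeDatum.mem_fil.2 fun i => ?_
  rcases eq_or_ne i j with rfl | h
  · rw [FreeDatum.e, Pi.single_eq_same, S.mem_shift_iff (zero_add _)]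
    exact S.one_mem
  · rw [FreeDatum.e, Pi.single_eq_of_ne h]
    exact zero_mem _

theorem FreeDatum.sum_smul_e {D : FreeDatum} (x : D.Mod A) : ∑ j, x j • D.e A j = x := by
  funext i
  simp [FreeDatum.e, Finset.sum_apply, Pi.single_apply]

theorem FreeDatum.map_eq_sum {D : FreeDatum} (φ : D.Mod A →ₗ[A] M) (x : D.Mod A) :
    φ x = ∑ j, x j • φ (D.e A j) := by
  conv_lhs => rw [← FreeDatum.sum_smul_e x, map_sum]
  exact Finset.sum_congr rfl fun j _ => map_smul φ _ _

/-! ### Minimality as a condition on the kernel. -/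

/-- A syzygy of a minimal F-basis has no component in `F_0 A`. -/
theorem IsMinimalFBasis.apply_eq_zero {FM : Filtration S M} {D : FreeDatum} {v : Fin D.rank → M}
    (hv : IsMinimalFBasis FM v)
    (hF : ∀ q x, x ∈ FM.F q ↔ ∃ c ∈ (D.fil S).F q, ∑ i, c i • v i = x)
    {c : D.Mod A} {j : Fin D.rank} (hc : c ∈ (D.fil S).F (D.deg j))
    (h0 : ∑ i, c i • v i = 0) : c j = 0 := by
  by_contra hne
  obtain ⟨u, hu⟩ := S.exists_eq_algebraMap ((S.mem_shift_iff (zero_add _)).1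
    (FreeDatum.mem_fil.1 hc j))
  have hu0 : u ≠ 0 := by
    rintro rfl
    exact hne (by rw [hu, map_zero])
  -- A nonzero `c j` is a unit `u` of `K`, so `v j` is a combination of the other members. They then
  -- form an F-basis with the same degrees `D.deg`.
  refine hv.2 (Finset.univ.erase j) (Finset.erase_ssubset (Finset.mem_univ j)).ne
    ⟨fun i => hv.1.1 i, fun i => D.deg i, fun q x => ?_⟩
  rw [hF]
  constructor
  · rintro ⟨f, hf, rfl⟩
    have hf' := FreeDatum.mem_fil.1 hf
    -- Subtracting `f j * u⁻¹` times the syzygy kills the `j`-th coefficient. The bounds survive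
    -- because `f j` has degree at most `q - deg j` and `c i` at most `deg j - deg i`.
    refine ⟨fun i => f i - f j * algebraMap K A u⁻¹ * c i, fun i => sub_mem (hf' i)
      (S.mul_mem_shift_of_mem_shift (S.mul_mem_shift_of_mem_shift (hf' j)
        ((S.mem_shift_iff (zero_add _)).2 (S.algebraMap_mem u⁻¹))) (FreeDatum.mem_fil.1 hc i)), ?_⟩
    have e1 : ∑ i, (f i - f j * algebraMap K A u⁻¹ * c i) • v i = ∑ i, f i • v i := by
      simp_rw [sub_smul, mul_smul _ (c _)]
      rw [Finset.sum_sub_distrib, ← Finset.smul_sum, h0, smul_zero, sub_zero]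
    rw [← e1, ← Finset.sum_erase Finset.univ (a := j), ← Finset.sum_coe_sort]
    rw [hu, mul_assoc, ← map_mul, inv_mul_cancel₀ hu0, map_one, mul_one, sub_self, zero_smul]
  · rintro ⟨f, hf, rfl⟩
    refine ⟨fun i => if h : i ∈ Finset.univ.erase j then f ⟨i, h⟩ else 0,
      FreeDatum.mem_fil.2 fun i => ?_, ?_⟩
    · split_ifs with h
      · exact hf ⟨i, h⟩
      · exact zero_mem _
    · rw [← Finset.sum_erase Finset.univ (a := j), ← Finset.sum_coe_sort]
      · exact Finset.sum_congr rfl fun i _ => by simp only [dif_pos i.2, Subtype.coe_eta]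
      · simp only [dif_neg (Finset.notMem_erase j _), zero_smul]

/-- A homomorphism from a filtered free module is *minimal* if an element of its kernel lying in
`F_q L` has zero coordinates at the basis elements of degree `q`. -/
def IsMinimalHom (S : WeightedFilteredSPA K A n) (D : FreeDatum) (φ : D.Mod A →ₗ[A] M) : Prop :=
  ∀ (x : D.Mod A) (j : Fin D.rank), x ∈ (D.fil S).F (D.deg j) → φ x = 0 → x j = 0

theorem IsMinimalFBasis.isMinimalHom {FM : Filtration S M} {D : FreeDatum} {φ : D.Mod A →ₗ[A] M}
    (hs : IsStrictHom (D.fil S) FM φ) (hφ : Function.Surjective φ)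
    (hv : IsMinimalFBasis FM fun j => φ (D.e A j)) : IsMinimalHom S D φ := by
  intro x j hx h0
  refine hv.apply_eq_zero (fun q y => ?_) hx (by rw [← FreeDatum.map_eq_sum, h0])
  have := Set.ext_iff.1 (hs q) y
  rw [hφ.range_eq, Set.univ_inter] at this
  simp_rw [← FreeDatum.map_eq_sum]
  exact this.symm

/-- Restricting the codomain to the image, with its induced filtration, reduces this to the
surjective case and does not change the kernel. -/
theorem IsMinimalStandardBasis.isMinimalHom {FM : Filtration S M} {D : FreeDatum}
    {φ : D.Mod A →ₗ[A] M} {N : Submodule A M} (hs : IsStrictHom (D.fil S) FM φ)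
    (hφ : LinearMap.range φ = N)
    (hv : IsMinimalStandardBasis FM N fun j => φ (D.e A j)) : IsMinimalHom S D φ := by
  subst hφ
  obtain ⟨_, hv⟩ := hv
  have hs' : IsStrictHom (D.fil S) (FM.sub (LinearMap.range φ)) φ.rangeRestrict := by
    intro q
    ext ⟨y, hy⟩
    have := Set.ext_iff.1 (hs q) y
    rw [φ.surjective_rangeRestrict.range_eq, Set.univ_inter]
    constructor
    · rintro ⟨x, hx, hxy⟩
      exact (this.1 ⟨x, hx, congrArg Subtype.val hxy⟩).2
    · intro h
      obtain ⟨x, hx, hxy⟩ := this.2 ⟨hy, h⟩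
      exact ⟨x, hx, Subtype.ext hxy⟩
  intro x j hx h0
  exact IsMinimalFBasis.isMinimalHom (φ := φ.rangeRestrict) hs' φ.surjective_rangeRestrict hv x j hx
    (Subtype.ext h0)

theorem isStrictHom_mkQ (FM : Filtration S M) (N : Submodule A M) :
    IsStrictHom FM (FM.quot N) N.mkQ := by
  intro q
  rw [N.mkQ_surjective.range_eq, Set.univ_inter]
  rfl

theorem IsStrictHom.exists_mem {FM : Filtration S M} {FM' : Filtration S M'} {φ : M →ₗ[A] M'}
    (h : IsStrictHom FM FM' φ) {q : ℕ} {x : M} (hx : φ x ∈ FM'.F q) :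
    ∃ y ∈ FM.F q, φ y = φ x :=
  (Set.ext_iff.1 (h q) (φ x)).2 ⟨⟨x, rfl⟩, hx⟩

/-! ### Lifting, and uniqueness of minimal filtered resolutions. -/

/-- Filtered free modules are projective with respect to strict filtered homomorphisms. -/
theorem FreeDatum.exists_lift {D : FreeDatum} {FM : Filtration S M} {FM' : Filtration S M'}
    {φ : D.Mod A →ₗ[A] M'} {φ' : M →ₗ[A] M'} (hφ : IsFilteredHom (D.fil S) FM' φ)
    (hφ' : IsStrictHom FM FM' φ') (hr : ∀ x, ∃ y, φ' y = φ x) :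
    ∃ ψ : D.Mod A →ₗ[A] M, IsFilteredHom (D.fil S) FM ψ ∧ ∀ x, φ' (ψ x) = φ x := by
  have h : ∀ j, ∃ y ∈ FM.F (D.deg j), φ' y = φ (D.e A j) := by
    intro j
    obtain ⟨y, hy⟩ := hr (D.e A j)
    rw [← hy]
    exact hφ'.exists_mem (hy ▸ hφ _ _ (D.e_mem S j))
  choose y hy hyφ using h
  -- `A` need not be commutative, so the auxiliary scalars of `constr` are taken in `ℕ`.
  refine ⟨(Pi.basisFun A (Fin D.rank)).constr ℕ y, fun q x hx => ?_, fun x => ?_⟩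
  · rw [Module.Basis.constr_apply_fintype]
    exact sum_mem fun j _ => FM.smul_mem_of_mem_shift (FreeDatum.mem_fil.1 hx j) (hy j)
  · rw [Module.Basis.constr_apply_fintype, map_sum, FreeDatum.map_eq_sum φ]
    exact Finset.sum_congr rfl fun j _ => by rw [map_smul, hyφ]; rfl

/-- A filtered endomorphism over `M` of a minimal filtered cover of `M` is bijective, and so is
its restriction to each filtration subgroup. -/
theorem IsMinimalHom.endomorphism_bijective {D : FreeDatum} {φ : D.Mod A →ₗ[A] M}
    (hφ : IsMinimalHom S D φ) {θ : D.Mod A →ₗ[A] D.Mod A}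
    (hθ : IsFilteredHom (D.fil S) (D.fil S) θ) (h : ∀ x, φ (θ x) = φ x) :
    Function.Injective θ ∧ ∀ q, ∀ x ∈ (D.fil S).F q, ∃ y ∈ (D.fil S).F q, θ y = x := by
  -- `θ - id` strictly lowers the top degree. It sends `e_i` into the kernel and into `F_{deg i}`,
  -- hence into `F_{deg j}` whenever `deg i ≤ deg j`, where minimality kills the `j`-th coordinate.
  have hη : ∀ (x : D.Mod A) (t : ℕ), (∀ j, t < D.deg j → x j = 0) →
      ∀ j, t ≤ D.deg j → (θ x - x) j = 0 := by
    intro x t hx j hj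
    have e : θ x - x = (θ - LinearMap.id : D.Mod A →ₗ[A] D.Mod A) x := rfl
    rw [e, FreeDatum.map_eq_sum, Finset.sum_apply]
    refine Finset.sum_eq_zero fun i _ => ?_
    rw [Pi.smul_apply, smul_eq_mul]
    rcases lt_or_ge t (D.deg i) with hi | hi
    · rw [hx i hi, zero_mul]
    · have hm : (θ - LinearMap.id : D.Mod A →ₗ[A] D.Mod A) (D.e A i) ∈ (D.fil S).F (D.deg j) :=
        (D.fil S).mono (hi.trans hj) (sub_mem (hθ _ _ (D.e_mem S i)) (D.e_mem S i))
      rw [hφ _ j hm (by rw [LinearMap.sub_apply, map_sub, h, LinearMap.id_apply, sub_self]),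
        mul_zero]
  obtain ⟨T, hT⟩ : ∃ T, ∀ j, D.deg j < T :=
    ⟨∑ j, D.deg j + 1, fun j => Nat.lt_succ_of_le (Finset.single_le_sum
      (f := D.deg) (fun _ _ => Nat.zero_le _) (Finset.mem_univ j))⟩
  constructor
  · rw [injective_iff_map_eq_zero]
    intro x hx
    -- Descending induction on `t` from the bound `T`: if `θ x = 0` then `θ x - x = -x`, so the top
    -- degree of `x` can always be lowered.
    have key : ∀ s t, t + s = T → ∀ j, t ≤ D.deg j → x j = 0 := by
      intro s
      induction s with
      | zero =>
        intro t ht j hj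
        have := hT j
        omega
      | succ s ih =>
        intro t ht j hj
        have := hη x t (fun i hi => ih (t + 1) (by omega) i hi) j hj
        rwa [hx, zero_sub, Pi.neg_apply, neg_eq_zero] at this
    funext j
    exact key T 0 (zero_add T) j (Nat.zero_le _)
  · intro q
    have key : ∀ t, ∀ x ∈ (D.fil S).F q, (∀ j, t ≤ D.deg j → x j = 0) →
        ∃ y ∈ (D.fil S).F q, θ y = x := by
      intro t
      induction t with
      | zero =>
        intro x hx h0
        exact ⟨x, hx, by rw [show x = 0 from funext fun j => h0 j (Nat.zero_le _), map_zero]⟩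
      | succ t ih =>
        intro x hx h0
        -- The error `θ x - x` has smaller top degree and so equals some `θ z`; then `θ (x - z) =
        -- x`.
        obtain ⟨z, hz, hzx⟩ := ih (θ x - x) (sub_mem (hθ q x hx) hx) (hη x t h0)
        exact ⟨x - z, sub_mem hx hz, by rw [map_sub, hzx, sub_sub_cancel]⟩
    exact fun x hx => key T x hx fun j hj => absurd (hT j) (Nat.not_lt.2 hj)

theorem IsFilteredHom.comp {M'' : Type*} [AddCommGroup M''] [Module A M''] {FM : Filtration S M}
    {FM' : Filtration S M'} {FM'' : Filtration S M''} {φ : M →ₗ[A] M'} {ψ : M' →ₗ[A] M''}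
    (hψ : IsFilteredHom FM' FM'' ψ) (hφ : IsFilteredHom FM FM' φ) :
    IsFilteredHom FM FM'' (ψ ∘ₗ φ) := fun q x hx => hψ q _ (hφ q x hx)

/-- A filtered isomorphism between the images of two minimal strict homomorphisms lifts to a
filtered isomorphism of the filtered free modules. -/
theorem IsMinimalHom.exists_equiv {D D' : FreeDatum} {FM : Filtration S M} {FM' : Filtration S M'}
    {φ : D.Mod A →ₗ[A] M} {φ' : D'.Mod A →ₗ[A] M'} (hφ : IsMinimalHom S D φ)
    (hφ' : IsMinimalHom S D' φ') (hf : IsFilteredHom (D.fil S) FM φ)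
    (hf' : IsFilteredHom (D'.fil S) FM' φ') (hs : IsStrictHom (D.fil S) FM φ)
    (hs' : IsStrictHom (D'.fil S) FM' φ') (χ : M ≃ₗ[A] M')
    (hχ : ∀ q, χ '' (FM.F q : Set M) = (FM'.F q : Set M'))
    (hr : ∀ x, x ∈ Set.range φ ↔ χ x ∈ Set.range φ') :
    ∃ ψ : D.Mod A ≃ₗ[A] D'.Mod A,
      (∀ q, ψ '' ((D.fil S).F q : Set (D.Mod A)) = ((D'.fil S).F q : Set (D'.Mod A))) ∧
        ∀ x, χ (φ x) = φ' (ψ x) := by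
  have hχ1 : IsFilteredHom FM FM' χ.toLinearMap := fun q x hx =>
    (Set.ext_iff.1 (hχ q) (χ x)).1 ⟨x, hx, rfl⟩
  have hχ2 : IsFilteredHom FM' FM χ.symm.toLinearMap := by
    intro q y hy
    obtain ⟨x, hx, rfl⟩ := (Set.ext_iff.1 (hχ q) y).2 hy
    simpa using hx
  obtain ⟨ψ, hψ, hψc⟩ := FreeDatum.exists_lift (φ := χ.toLinearMap ∘ₗ φ) (φ' := φ')
    (hχ1.comp hf) hs' fun x => (hr (φ x)).1 ⟨x, rfl⟩
  obtain ⟨ξ, hξ, hξc⟩ := FreeDatum.exists_lift (φ := χ.symm.toLinearMap ∘ₗ φ') (φ' := φ)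
    (hχ2.comp hf') hs fun x => (hr _).2 (by simp)
  simp only [LinearMap.comp_apply, LinearEquiv.coe_coe] at hψc hξc
  -- Both composites lie over the identity. The first gives injectivity of `ψ`, the second its
  -- surjectivity on each `F_q`.
  obtain ⟨i1, s1⟩ := hφ.endomorphism_bijective (hξ.comp hψ) fun x => by
    rw [LinearMap.comp_apply, hξc, hψc, LinearEquiv.symm_apply_apply]
  obtain ⟨-, s2⟩ := hφ'.endomorphism_bijective (hψ.comp hξ) fun x => by
    rw [LinearMap.comp_apply, hψc, hξc, LinearEquiv.apply_symm_apply]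
  have inj : Function.Injective ψ := fun x y hxy => i1 (congrArg ξ hxy)
  have surj : ∀ q, ∀ y ∈ (D'.fil S).F q, ∃ x ∈ (D.fil S).F q, ψ x = y := by
    intro q y hy
    obtain ⟨z, hz, rfl⟩ := s2 q y hy
    exact ⟨ξ z, hξ q z hz, rfl⟩
  refine ⟨LinearEquiv.ofBijective ψ ⟨inj, fun y => ?_⟩, fun q => ?_, fun x => (hψc x).symm⟩
  · obtain ⟨q, hq⟩ := (D'.fil S).exhaust y
    obtain ⟨x, -, hx⟩ := surj q y hq
    exact ⟨x, hx⟩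
  · ext y
    constructor
    · rintro ⟨x, hx, rfl⟩
      exact hψ q x hx
    · intro hy
      exact surj q y hy

variable {L₀ : FreeDatum} {N : Submodule A (L₀.Mod A)}

theorem MinimalFilteredFreeResolution.isMinimalHom_mkQ (L : MinimalFilteredFreeResolution S L₀ N) :
    IsMinimalHom S L₀ N.mkQ :=
  L.minimal_aug.isMinimalHom (isStrictHom_mkQ _ N) N.mkQ_surjective

theorem MinimalFilteredFreeResolution.isMinimalHom_d (L : MinimalFilteredFreeResolution S L₀ N)
    (i : ℕ) : IsMinimalHom S (L.obj (i + 1)) (L.d i) := by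
  cases i with
  | zero => exact L.minimal_zero.isMinimalHom (L.strict 0) (LinearMap.exact_iff.1 L.exact_aug).symm
  | succ i =>
    exact (L.minimal i).isMinimalHom (L.strict (i + 1)) (LinearMap.exact_iff.1 (L.exact i)).symm

/-- Minimal filtered free resolutions of the same module are isomorphic. -/
theorem MinimalFilteredFreeResolution.exists_equiv (L L' : MinimalFilteredFreeResolution S L₀ N) :
    ∃ χ : ∀ i, (L.obj i).Mod A ≃ₗ[A] (L'.obj i).Mod A,
      χ 0 = LinearEquiv.refl A (L₀.Mod A) ∧
      (∀ i q, χ i '' (((L.obj i).fil S).F q : Set ((L.obj i).Mod A)) =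
        (((L'.obj i).fil S).F q : Set ((L'.obj i).Mod A))) ∧
      ∀ i x, χ i (L.d i x) = L'.d i (χ (i + 1) x) := by
  -- Matching the images of `d i` is carried along because it is what permits the next lift. It
  -- propagates by exactness, since the next images are the kernels of `d i`; at the start both
  -- images are `N`.
  let P (i : ℕ) (χ : (L.obj i).Mod A ≃ₗ[A] (L'.obj i).Mod A) : Prop :=
    (∀ q, χ '' (((L.obj i).fil S).F q : Set ((L.obj i).Mod A)) =
      (((L'.obj i).fil S).F q : Set ((L'.obj i).Mod A))) ∧
    ∀ x, x ∈ Set.range (L.d i) ↔ χ x ∈ Set.range (L'.d i)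
  have step : ∀ i (χ : {χ // P i χ}), ∃ ψ : {ψ // P (i + 1) ψ},
      ∀ x, χ.1 (L.d i x) = L'.d i (ψ.1 x) := by
    rintro i ⟨χ, hχ, hr⟩
    obtain ⟨ψ, hψ, hc⟩ := (L.isMinimalHom_d i).exists_equiv (L'.isMinimalHom_d i) (L.filtered i)
      (L'.filtered i) (L.strict i) (L'.strict i) χ hχ hr
    refine ⟨⟨ψ, hψ, fun x => ?_⟩, hc⟩
    rw [← L.exact i x, ← L'.exact i (ψ x), ← hc, LinearEquiv.map_eq_zero_iff]
  choose next hnext using step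
  let s : ∀ i, {χ // P i χ} := fun i => Nat.rec
    ⟨LinearEquiv.refl A (L₀.Mod A), fun q => Set.image_id _, fun x =>
      (L.exact_aug x).symm.trans (L'.exact_aug x)⟩ (fun i χ => next i χ) i
  exact ⟨fun i => (s i).1, rfl, fun i => (s i).2.1, fun i => hnext i (s i)⟩

end

/-! ### Components of multiples of a homogeneous element. -/

section

variable {𝒜 : ℕ → Type*} [∀ p, AddCommGroup (𝒜 p)] [DirectSum.GRing 𝒜]
variable {ℳ : ℕ → Type*} [∀ q, AddCommGroup (ℳ q)] [DirectSum.Gmodule 𝒜 ℳ]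

theorem smul_of_apply_add (C : ⨁ p, 𝒜 p) {b : ℕ} (y : ℳ b) (p : ℕ) :
    (C • DirectSum.of ℳ b y) (p +ᵥ b) = GradedMonoid.GSMul.smul (C p) y := by
  induction C using DirectSum.induction_on with
  | zero => rw [zero_smul, DirectSum.zero_apply, DirectSum.zero_apply, DirectSum.Gmodule.zero_smul]
  | add C C' h h' =>
    rw [add_smul, DirectSum.add_apply, DirectSum.add_apply, DirectSum.Gmodule.add_smul, h, h']
  | of p' a =>
    rw [DirectSum.Gmodule.of_smul_of]
    rcases eq_or_ne p' p with rfl | hp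
    · rw [DirectSum.of_eq_same, DirectSum.of_eq_same]
    · rw [DirectSum.of_eq_of_ne _ _ _ hp.symm, DirectSum.Gmodule.zero_smul]
      exact DirectSum.of_eq_of_ne _ _ _ fun h => hp (Nat.add_right_cancel h).symm

theorem smul_of_apply_of_lt (C : ⨁ p, 𝒜 p) {b q : ℕ} (y : ℳ b) (h : q < b) :
    (C • DirectSum.of ℳ b y) q = 0 := by
  induction C using DirectSum.induction_on with
  | zero => rw [zero_smul, DirectSum.zero_apply]
  | add C C' h h' => rw [add_smul, DirectSum.add_apply, h, h', add_zero]
  | of p a =>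
    rw [DirectSum.Gmodule.of_smul_of]
    exact DirectSum.of_eq_of_ne _ _ _ (h.trans_le (Nat.le_add_left b p)).ne

end

/-! ### The associated graded and Rees modules treated together. -/

section

variable {K A : Type*} [Field K] [Ring A] [Algebra K A] {n : ℕ} {S : WeightedFilteredSPA K A n}
variable {M : Type*} [AddCommGroup M] [Module A M]
variable {M' : Type*} [AddCommGroup M'] [Module A M']
variable {M'' : Type*} [AddCommGroup M''] [Module A M'']

/-- The subgroups by which the `F_q` are divided: `F_{q-1}` for the associated graded module
(`t = true`), and zero for the Rees module (`t = false`). -/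
def lowPart (t : Bool) (F : ℕ → AddSubgroup M) (q : ℕ) : AddSubgroup M :=
  match t with
  | true => below F q
  | false => ⊥

theorem mem_lowPart_zero {t : Bool} {F : ℕ → AddSubgroup M} {x : M} :
    x ∈ lowPart t F 0 ↔ x = 0 := by
  cases t <;> exact Iff.rfl

theorem Filtration.lowPart_le (FM : Filtration S M) (t : Bool) (q : ℕ) :
    lowPart t FM.F q ≤ FM.F q := by
  cases t with
  | false => exact bot_le
  | true =>
    cases q with
    | zero => exact bot_le
    | succ q => exact FM.mono (Nat.le_succ q)

/-- The shift of indices matters when `t = true` and `p = 0`: then `e_j` has degree exactly `q`, so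
it cannot occur in an element of `F_{q-1} L`. -/
theorem FreeDatum.apply_mem_lowPart {D : FreeDatum} {t : Bool} {q p : ℕ} {x : D.Mod A}
    (hx : x ∈ lowPart t (D.fil S).F q) {j : Fin D.rank} (h : p + D.deg j = q) :
    x j ∈ lowPart t S.F p := by
  cases t with
  | false =>
    have : x = 0 := hx
    rw [this]
    exact zero_mem _
  | true =>
    cases q with
    | zero =>
      have : x = 0 := hx
      rw [this]
      exact zero_mem _
    | succ q =>
      have hj : x j ∈ S.shift (D.deg j) q := FreeDatum.mem_fil.1 hx j
      cases p with
      | zero =>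
        rw [S.eq_zero_of_mem_shift (by omega) hj]
        exact zero_mem _
      | succ p => exact (S.mem_shift_iff (by omega)).1 hj

/-- For `t = true` this is strictness one step lower, at `q - 1`; in the remaining cases `φ x = 0`
and zero is a lift. -/
theorem IsStrictHom.exists_mem_lowPart {FM : Filtration S M} {FM' : Filtration S M'}
    {φ : M →ₗ[A] M'} (h : IsStrictHom FM FM' φ) {t : Bool} {q : ℕ} {x : M}
    (hx : φ x ∈ lowPart t FM'.F q) : ∃ y ∈ lowPart t FM.F q, φ y = φ x := by
  have key (hx : φ x = 0) : ∃ y ∈ lowPart t FM.F q, φ y = φ x :=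
    ⟨0, zero_mem _, by rw [hx, map_zero]⟩
  cases t with
  | false => exact key hx
  | true =>
    cases q with
    | zero => exact key hx
    | succ q => exact h.exists_mem hx

/-- A presentation of the pieces of a graded module as the quotients of the `F_q M` by the
subgroups `lowPart t`. -/
structure PiecePresentation (F : ℕ → AddSubgroup M) (t : Bool) (ℳ : ℕ → Type*)
    [∀ q, AddCommGroup (ℳ q)] where
  /-- the quotient maps -/
  proj : ∀ q, F q →+ ℳ q
  surjective : ∀ q, Function.Surjective (proj q)
  eq_zero_iff : ∀ q (x : F q), proj q x = 0 ↔ (x : M) ∈ lowPart t F q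

theorem PiecePresentation.of_proj_congr {F : ℕ → AddSubgroup M} {t : Bool} {ℳ : ℕ → Type*}
    [∀ q, AddCommGroup (ℳ q)] (μ : PiecePresentation F t ℳ) {p q : ℕ} (h : p = q)
    {x : F p} {y : F q} (hxy : (x : M) = y) :
    DirectSum.of ℳ p (μ.proj p x) = DirectSum.of ℳ q (μ.proj q y) := by
  subst h
  rw [Subtype.ext hxy]

variable {𝒜 : ℕ → Type*} [∀ p, AddCommGroup (𝒜 p)] [DirectSum.GRing 𝒜]
variable {ℳ : ℕ → Type*} [∀ q, AddCommGroup (ℳ q)] [DirectSum.Gmodule 𝒜 ℳ]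
variable {ℳ' : ℕ → Type*} [∀ q, AddCommGroup (ℳ' q)] [DirectSum.Gmodule 𝒜 ℳ']
variable {ℳ'' : ℕ → Type*} [∀ q, AddCommGroup (ℳ'' q)] [DirectSum.Gmodule 𝒜 ℳ'']
variable {t : Bool} {FM : Filtration S M} {FM' : Filtration S M'} {FM'' : Filtration S M''}

/-- The quotient maps commute with the multiplication. -/
def PiecePresentation.Compatible (μ : PiecePresentation FM.F t ℳ)
    (α : PiecePresentation S.F t 𝒜) : Prop :=
  ∀ (p q : ℕ) (a : S.F p) (x : FM.F q),
    GradedMonoid.GSMul.smul (α.proj p a) (μ.proj q x) = μ.proj (p + q) (FM.smulF a x)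

/-- `f` is the homomorphism of graded modules induced by the filtered homomorphism `φ`. -/
def Induces (μ : PiecePresentation FM.F t ℳ) (μ' : PiecePresentation FM'.F t ℳ') (φ : M →ₗ[A] M')
    (f : (⨁ q, ℳ q) →ₗ[⨁ p, 𝒜 p] (⨁ q, ℳ' q)) : Prop :=
  ∀ q (x : FM.F q) (y : FM'.F q), (y : M') = φ x →
    f (DirectSum.of ℳ q (μ.proj q x)) = DirectSum.of ℳ' q (μ'.proj q y)

theorem Induces.isGradedHom {μ : PiecePresentation FM.F t ℳ} {μ' : PiecePresentation FM'.F t ℳ'}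
    {φ : M →ₗ[A] M'} {f : (⨁ q, ℳ q) →ₗ[⨁ p, 𝒜 p] (⨁ q, ℳ' q)} (h : Induces μ μ' φ f)
    (hφ : IsFilteredHom FM FM' φ) : IsGradedHom f := by
  intro q x
  obtain ⟨x, rfl⟩ := μ.surjective q x
  exact ⟨_, h q x ⟨φ x, hφ q x x.2⟩ rfl⟩

theorem IsGradedHom.map_apply {f : (⨁ q, ℳ q) →ₗ[⨁ p, 𝒜 p] (⨁ q, ℳ' q)} (hf : IsGradedHom f)
    (y : ⨁ q, ℳ q) (q : ℕ) : f y q = f (DirectSum.of ℳ q (y q)) q := by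
  induction y using DirectSum.induction_on with
  | zero => rw [DirectSum.zero_apply, map_zero, map_zero, map_zero, DirectSum.zero_apply]
  | add y z hy hz => rw [map_add, DirectSum.add_apply, DirectSum.add_apply, map_add, map_add,
      DirectSum.add_apply, hy, hz]
  | of p x =>
    rcases eq_or_ne q p with rfl | h
    · rw [DirectSum.of_eq_same]
    · obtain ⟨z, hz⟩ := hf p x
      rw [DirectSum.of_eq_of_ne _ _ _ h, hz, DirectSum.of_eq_of_ne _ _ _ h, map_zero, map_zero,
        DirectSum.zero_apply]

theorem IsGradedHom.map_of_eq_zero {f : (⨁ q, ℳ q) →ₗ[⨁ p, 𝒜 p] (⨁ q, ℳ' q)}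
    (hf : IsGradedHom f) {y : ⨁ q, ℳ q} (hy : f y = 0) (q : ℕ) :
    f (DirectSum.of ℳ q (y q)) = 0 := by
  have h := hf.map_apply y q
  obtain ⟨z, hz⟩ := hf q (y q)
  rw [hy, DirectSum.zero_apply, hz, DirectSum.of_eq_same] at h
  rw [hz, ← h, map_zero]

/-- Reduces surjectivity, exactness and spanning to homogeneous elements. -/
theorem mem_of_forall_of_mem {P : AddSubgroup (⨁ q, ℳ q)} {y : ⨁ q, ℳ q}
    (h : ∀ q, DirectSum.of ℳ q (y q) ∈ P) : y ∈ P := by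
  classical
  rw [← DirectSum.sum_support_of y]
  exact sum_mem fun q _ => h q

theorem Induces.surjective {μ : PiecePresentation FM.F t ℳ} {μ' : PiecePresentation FM'.F t ℳ'}
    {φ : M →ₗ[A] M'} {f : (⨁ q, ℳ q) →ₗ[⨁ p, 𝒜 p] (⨁ q, ℳ' q)} (h : Induces μ μ' φ f)
    (hs : IsStrictHom FM FM' φ) (hφ : Function.Surjective φ) : Function.Surjective f := by
  intro y
  refine mem_of_forall_of_mem (P := f.toAddMonoidHom.range) fun q => ?_
  obtain ⟨z, hz⟩ := μ'.surjective q (y q)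
  obtain ⟨x, hx⟩ := hφ z
  obtain ⟨x', hx', he⟩ := hs.exists_mem (x := x) (q := q) (hx ▸ z.2)
  exact ⟨_, (h q ⟨x', hx'⟩ z (by rw [he, hx])).trans (by rw [hz])⟩

theorem Induces.exact {μ : PiecePresentation FM.F t ℳ} {μ' : PiecePresentation FM'.F t ℳ'}
    {μ'' : PiecePresentation FM''.F t ℳ''} {φ : M →ₗ[A] M'} {ψ : M' →ₗ[A] M''}
    {f : (⨁ q, ℳ q) →ₗ[⨁ p, 𝒜 p] (⨁ q, ℳ' q)} {g : (⨁ q, ℳ' q) →ₗ[⨁ p, 𝒜 p] (⨁ q, ℳ'' q)}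
    (hf : Induces μ μ' φ f) (hg : Induces μ' μ'' ψ g) (hφ : IsFilteredHom FM FM' φ)
    (hψ : IsFilteredHom FM' FM'' ψ) (hφs : IsStrictHom FM FM' φ) (hψs : IsStrictHom FM' FM'' ψ)
    (h : Function.Exact φ ψ) : Function.Exact f g := by
  intro y
  constructor
  · intro hy
    refine mem_of_forall_of_mem (P := f.toAddMonoidHom.range) fun q => ?_
    have h0 := (hg.isGradedHom hψ).map_of_eq_zero hy q
    obtain ⟨z, hz⟩ := μ'.surjective q (y q)
    rw [← hz, hg q z ⟨ψ z, hψ q z z.2⟩ rfl] at h0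
    have h1 := (μ''.eq_zero_iff q _).1 (DirectSum.of_injective q (h0.trans (map_zero _).symm))
    -- A representative `z` of a cycle satisfies `ψ z = 0` only modulo `lowPart`. Strictness of `ψ`
    -- gives a correction `w` that does not change the class of `z` and makes `z - w` a true cycle;
    -- strictness of `φ` then lifts it within `F_q`.
    obtain ⟨w, hw, hwz⟩ := hψs.exists_mem_lowPart h1
    have hwF := FM'.lowPart_le t q hw
    obtain ⟨x, hx⟩ := (h (z - w)).1 (by rw [map_sub, hwz, sub_self])
    obtain ⟨x', hx', he⟩ := hφs.exists_mem (x := x) (q := q) (hx ▸ sub_mem z.2 hwF)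
    refine ⟨_, (hf q ⟨x', hx'⟩ (z - ⟨w, hwF⟩) (by rw [he, hx]; rfl)).trans ?_⟩
    rw [map_sub, (μ'.eq_zero_iff q ⟨w, hwF⟩).2 hw, sub_zero, hz]
  · rintro ⟨x, rfl⟩
    induction x using DirectSum.induction_on with
    | zero => rw [map_zero, map_zero]
    | add x y hx hy => rw [map_add, map_add, hx, hy, add_zero]
    | of q x =>
      obtain ⟨x, rfl⟩ := μ.surjective q x
      rw [hf q x ⟨φ x, hφ q x x.2⟩ rfl, hg q _ 0 (h.apply_apply_eq_zero x).symm, map_zero, map_zero]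

theorem PiecePresentation.Compatible.smul_of_apply {μ : PiecePresentation FM.F t ℳ}
    {α : PiecePresentation S.F t 𝒜} (hμ : μ.Compatible α) (C : ⨁ p, 𝒜 p) {b : ℕ}
    (x : FM.F b) (q : ℕ) :
    ∃ c ∈ S.shift b q, ∃ y : FM.F q, (y : M) = c • (x : M) ∧
      (C • DirectSum.of ℳ b (μ.proj b x)) q = μ.proj q y ∧
      ∀ p, p + b = q → ∃ a : S.F p, (a : A) = c ∧ C p = α.proj p a := by
  rcases lt_or_ge q b with h | h
  · refine ⟨0, zero_mem _, 0, (zero_smul A _).symm, ?_, fun p hp => ?_⟩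
    · rw [smul_of_apply_of_lt C _ h, map_zero]
    · omega
  · obtain ⟨p, rfl⟩ := Nat.exists_eq_add_of_le' h
    obtain ⟨a, ha⟩ := α.surjective p (C p)
    refine ⟨(a : A), (S.mem_shift_iff rfl).2 a.2, FM.smulF a x, rfl, ?_, fun p' hp' => ?_⟩
    · rw [← hμ, ha]
      exact smul_of_apply_add C _ p
    · obtain rfl := Nat.add_right_cancel hp'
      exact ⟨a, rfl, ha.symm⟩

/-! ### Homogeneous bases, and minimality of their images. -/

section free

variable {D : FreeDatum} {α : PiecePresentation S.F t 𝒜}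
  {μ : PiecePresentation (D.fil S).F t ℳ}

/-- The homogeneous element of degree `deg j` given by the basis element `e_j`. -/
def PiecePresentation.basisElt (μ : PiecePresentation (D.fil S).F t ℳ) (j : Fin D.rank) :
    ⨁ q, ℳ q :=
  DirectSum.of ℳ (D.deg j) (μ.proj (D.deg j) ⟨D.e A j, D.e_mem S j⟩)

/-- Translates between graded coefficients and filtered coordinates: in degree `q`, the coefficient
of `e_j` matters only through its component of degree `q - deg j`, and the coordinates of one `c` in
`F_q L` represent all of these. -/
theorem PiecePresentation.Compatible.sum_smul_basisElt_apply (hμ : μ.Compatible α)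
    (C : Fin D.rank → ⨁ p, 𝒜 p) (q : ℕ) :
    ∃ c : (D.fil S).F q, (∑ j, C j • μ.basisElt j) q = μ.proj q c ∧
      ∀ j p, p + D.deg j = q → ∃ a : S.F p, (a : A) = (c : D.Mod A) j ∧ C j p = α.proj p a := by
  choose c hc y hy hCy hCc using fun j => hμ.smul_of_apply (C j) ⟨D.e A j, D.e_mem S j⟩ q
  have h : ∑ j, y j = ⟨c, FreeDatum.mem_fil.2 hc⟩ := by
    refine Subtype.ext ?_
    rw [AddSubgroup.val_finsetSum]
    simp_rw [hy]
    exact FreeDatum.sum_smul_e c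
  refine ⟨⟨c, FreeDatum.mem_fil.2 hc⟩, ?_, hCc⟩
  rw [DirectSum.sum_apply, ← h, map_sum]
  exact Finset.sum_congr rfl fun j _ => hCy j

theorem PiecePresentation.Compatible.linearIndependent (hμ : μ.Compatible α) :
    LinearIndependent (⨁ p, 𝒜 p) μ.basisElt := by
  rw [Fintype.linearIndependent_iff]
  intro C hC j
  ext p : 1
  obtain ⟨c, hc, h⟩ := hμ.sum_smul_basisElt_apply C (p + D.deg j)
  rw [hC, DirectSum.zero_apply] at hc
  obtain ⟨a, ha, haC⟩ := h j p rfl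
  rw [haC, DirectSum.zero_apply, α.eq_zero_iff, ha]
  exact FreeDatum.apply_mem_lowPart ((μ.eq_zero_iff _ c).1 hc.symm) rfl

theorem PiecePresentation.Compatible.span_eq_top (hμ : μ.Compatible α) :
    Submodule.span (⨁ p, 𝒜 p) (Set.range μ.basisElt) = ⊤ := by
  refine eq_top_iff.2 fun y _ => ?_
  refine mem_of_forall_of_mem
    (P := Submodule.toAddSubgroup (Submodule.span (⨁ p, 𝒜 p) _)) fun q => ?_
  obtain ⟨x, hx⟩ := μ.surjective q (y q)
  have hj : ∀ j, (x : D.Mod A) j • D.e A j ∈ (D.fil S).F q := fun j =>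
    (D.fil S).smul_mem_of_mem_shift (FreeDatum.mem_fil.1 x.2 j) (D.e_mem S j)
  have hsum : x = ∑ j, (⟨(x : D.Mod A) j • D.e A j, hj j⟩ : (D.fil S).F q) := by
    refine Subtype.ext ?_
    rw [AddSubgroup.val_finsetSum]
    exact (FreeDatum.sum_smul_e _).symm
  rw [← hx, hsum, map_sum, map_sum]
  refine sum_mem fun j _ => ?_
  have hxj := FreeDatum.mem_fil.1 x.2 j
  rcases lt_or_ge q (D.deg j) with h | h
  · have : (⟨(x : D.Mod A) j • D.e A j, hj j⟩ : (D.fil S).F q) = 0 :=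
      Subtype.ext ((congrArg (· • D.e A j) (S.eq_zero_of_mem_shift h hxj)).trans (zero_smul A _))
    rw [this, map_zero, map_zero]
    exact zero_mem _
  · obtain ⟨p, hp⟩ := Nat.exists_eq_add_of_le' h
    have e : DirectSum.of ℳ q (μ.proj q ⟨(x : D.Mod A) j • D.e A j, hj j⟩) =
        DirectSum.of 𝒜 p (α.proj p ⟨(x : D.Mod A) j, (S.mem_shift_iff hp.symm).1 hxj⟩) •
          μ.basisElt j := by
      rw [PiecePresentation.basisElt, DirectSum.Gmodule.of_smul_of, hμ]
      exact μ.of_proj_congr hp rfl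
    rw [e]
    exact Submodule.smul_mem _ _ (Submodule.subset_span ⟨j, rfl⟩)

/-- The graded module of a filtered free module is free. -/
def PiecePresentation.Compatible.basis (hμ : μ.Compatible α) :
    Module.Basis (Fin D.rank) (⨁ p, 𝒜 p) (⨁ q, ℳ q) :=
  Module.Basis.mk hμ.linearIndependent hμ.span_eq_top.ge

theorem PiecePresentation.Compatible.basis_apply (hμ : μ.Compatible α) (j : Fin D.rank) :
    hμ.basis j = μ.basisElt j := Module.Basis.mk_apply _ _ _

/-- A presentation is not required to send `1` to `1`. But if the unit vanished, the graded ring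
would be zero and the class of `1` in degree zero would vanish, although nothing is divided out
there. -/
theorem one_apply_zero_ne_zero (α : PiecePresentation S.F t 𝒜) : (1 : ⨁ p, 𝒜 p) 0 ≠ 0 := by
  intro h
  have h1 : (1 : ⨁ p, 𝒜 p) = 0 := by
    have e : (1 : ⨁ p, 𝒜 p) = DirectSum.of 𝒜 0 GradedMonoid.GOne.one := rfl
    rw [e, DirectSum.of_eq_same] at h
    rw [e, h, map_zero]
  have h2 : DirectSum.of 𝒜 0 (α.proj 0 ⟨1, S.one_mem⟩) = 0 := by
    rw [← one_mul (DirectSum.of 𝒜 0 _), h1, zero_mul]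
  have h3 := (α.eq_zero_iff 0 _).1 (DirectSum.of_injective 0 (h2.trans (map_zero _).symm))
  have := S.nontrivial
  exact one_ne_zero (mem_lowPart_zero.1 h3)

variable {φ : D.Mod A →ₗ[A] M'} {f : (⨁ q, ℳ q) →ₗ[⨁ p, 𝒜 p] (⨁ q, ℳ' q)}
  {μ' : PiecePresentation FM'.F t ℳ'}

theorem Induces.repr_apply_zero (h : Induces μ μ' φ f) (hμ : μ.Compatible α)
    (hφ : IsFilteredHom (D.fil S) FM' φ) (hs : IsStrictHom (D.fil S) FM' φ)
    (hm : IsMinimalHom S D φ) {y : ⨁ q, ℳ q} (hy : f y = 0) (j : Fin D.rank) :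
    hμ.basis.repr y j 0 = 0 := by
  obtain ⟨c, hc, hC⟩ := hμ.sum_smul_basisElt_apply (fun i => hμ.basis.repr y i) (D.deg j)
  have hsum : ∑ i, hμ.basis.repr y i • μ.basisElt i = y := by
    simp_rw [← hμ.basis_apply]
    exact hμ.basis.sum_repr y
  rw [hsum] at hc
  have h0 := (h.isGradedHom hφ).map_of_eq_zero hy (D.deg j)
  rw [hc, h _ c ⟨φ c, hφ _ c c.2⟩ rfl] at h0
  have h1 := (μ'.eq_zero_iff _ _).1 (DirectSum.of_injective _ (h0.trans (map_zero _).symm))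
  -- As in the exactness proof, `c - w` lies in the kernel, so minimality kills its `j`-th
  -- coordinate. That of `w` vanishes as well: it lies in the low part of `F_0 A`, which is zero.
  obtain ⟨w, hw, hwc⟩ := hs.exists_mem_lowPart h1
  have h2 := hm ((c : D.Mod A) - w) j (sub_mem c.2 ((D.fil S).lowPart_le t _ hw))
    (by rw [map_sub, hwc, sub_self])
  rw [Pi.sub_apply, mem_lowPart_zero.1 (FreeDatum.apply_mem_lowPart hw (zero_add _)),
    sub_zero] at h2
  obtain ⟨a, ha, haC⟩ := hC j 0 (zero_add _)
  rw [haC, α.eq_zero_iff, ha, h2]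
  exact zero_mem _

theorem Induces.isMinimalHomogeneousGenerators (h : Induces μ μ' φ f) (hμ : μ.Compatible α)
    (hφ : IsFilteredHom (D.fil S) FM' φ) (hs : IsStrictHom (D.fil S) FM' φ)
    (hm : IsMinimalHom S D φ) :
    IsMinimalHomogeneousGenerators (LinearMap.range f) (fun j => f (hμ.basis j)) := by
  refine ⟨fun j => ?_, ?_, fun T hT hspan => ?_⟩
  · obtain ⟨y, hy⟩ := h.isGradedHom hφ _ (μ.proj (D.deg j) ⟨D.e A j, D.e_mem S j⟩)
    exact ⟨_, y, (congrArg f (hμ.basis_apply j)).trans hy⟩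
  · rw [Set.range_comp' f, Submodule.span_image, hμ.basis.span_eq, Submodule.map_top]
  · obtain ⟨j, hj⟩ := (Set.ne_univ_iff_exists_notMem T).1 hT
    have hmem : f (hμ.basis j) ∈ LinearMap.range f := ⟨_, rfl⟩
    rw [← hspan, ← Set.image_image f hμ.basis, Submodule.span_image] at hmem
    obtain ⟨z, hz, hzj⟩ := hmem
    -- If the members indexed by `T` suffice, `f e_j = f z` with `z` not involving `e_j`. The kernel
    -- element `z - e_j` then has `j`-th coordinate `-1`, whose degree-zero component is nonzero.
    have h0 := h.repr_apply_zero hμ hφ hs hm (y := z - hμ.basis j)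
      (by rw [map_sub, hzj, sub_self]) j
    have hzero : hμ.basis.repr z j = 0 := by
      by_contra hne
      exact hj (hμ.basis.mem_span_image.1 hz (Finsupp.mem_support_iff.2 hne))
    rw [map_sub, Finsupp.sub_apply, hzero, Module.Basis.repr_self, Finsupp.single_eq_same,
      DirectSum.sub_apply, DirectSum.zero_apply, zero_sub, neg_eq_zero] at h0
    exact one_apply_zero_ne_zero α h0

end free

/-! ### Assembly of the graded resolutions. -/

variable {L₀ : FreeDatum} {N : Submodule A (L₀.Mod A)}

theorem MinimalFilteredFreeResolution.isMinimalGradedFreeResolution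
    (L : MinimalFilteredFreeResolution S L₀ N) {α : PiecePresentation S.F t 𝒜}
    {ℒ : ℕ → ℕ → Type*} [∀ i q, AddCommGroup (ℒ i q)] [∀ i, DirectSum.Gmodule 𝒜 (ℒ i)]
    (lam : ∀ i, PiecePresentation ((L.obj i).fil S).F t (ℒ i)) (hlam : ∀ i, (lam i).Compatible α)
    (μ : PiecePresentation ((L₀.fil S).quot N).F t ℳ)
    {d : ∀ i, DirectSum ℕ (ℒ (i + 1)) →ₗ[⨁ p, 𝒜 p] DirectSum ℕ (ℒ i)}
    {ε : DirectSum ℕ (ℒ 0) →ₗ[⨁ p, 𝒜 p] (⨁ q, ℳ q)}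
    (hd : ∀ i, Induces (lam (i + 1)) (lam i) (L.d i) (d i))
    (hε : Induces (lam 0) μ N.mkQ ε) : IsMinimalGradedFreeResolution d ε := by
  have hεf := isFilteredHom_mkQ (L₀.fil S) N
  have hεs := isStrictHom_mkQ (L₀.fil S) N
  have surj := hε.surjective hεs N.mkQ_surjective
  have exact_aug := (hd 0).exact hε (L.filtered 0) hεf (L.strict 0) hεs L.exact_aug
  have exact i := (hd (i + 1)).exact (hd i) (L.filtered (i + 1)) (L.filtered i)
    (L.strict (i + 1)) (L.strict i) (L.exact i)
  have gens i := (hd i).isMinimalHomogeneousGenerators (hlam (i + 1)) (L.filtered i) (L.strict i)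
    (L.isMinimalHom_d i)
  refine ⟨hε.isGradedHom hεf, fun i => (hd i).isGradedHom (L.filtered i), surj, exact_aug, exact,
    fun i => (L.obj i).rank, fun i => (hlam i).basis,
    fun i j => ⟨_, _, (hlam i).basis_apply j⟩, ?_, ?_, fun i => ?_⟩
  · rw [← LinearMap.range_eq_top.2 surj]
    exact hε.isMinimalHomogeneousGenerators (hlam 0) hεf hεs L.isMinimalHom_mkQ
  · rw [LinearMap.exact_iff.1 exact_aug]
    exact gens 0
  · rw [LinearMap.exact_iff.1 (exact i)]
    exact gens (i + 1)

/-- The pieces of the associated graded module. -/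
def grPresentation (F : ℕ → AddSubgroup M) :
    PiecePresentation F true (GrPiece F) where
  proj := grMk F
  surjective := grMk_surjective F
  eq_zero_iff _ x := QuotientAddGroup.eq_zero_iff x

/-- The pieces of the Rees module. -/
def reesPresentation (F : ℕ → AddSubgroup M) :
    PiecePresentation F false (fun q => F q) where
  proj q := AddMonoidHom.id (F q)
  surjective _ := Function.surjective_id
  eq_zero_iff _ _ := Subtype.ext_iff

theorem IsFilteredHom.induces_gr {φ : M →ₗ[A] M'} (h : IsFilteredHom FM FM' φ) :
    Induces (grPresentation FM.F) (grPresentation FM'.F) φ h.gr := by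
  intro q x y hy
  obtain rfl : y = ⟨φ x, h q x x.2⟩ := Subtype.ext hy
  exact DirectSum.map_of _ _ _

theorem IsFilteredHom.induces_rees {φ : M →ₗ[A] M'} (h : IsFilteredHom FM FM' φ) :
    Induces (reesPresentation FM.F) (reesPresentation FM'.F) φ h.rees := by
  intro q x y hy
  obtain rfl : y = ⟨φ x, h q x x.2⟩ := Subtype.ext hy
  exact DirectSum.map_of _ _ _

end

end FilteredRes

end

theorem theorem6p3 {K A : Type*} [Field K] [Ring A] [Algebra K A] {n : ℕ}
    (S : FilteredRes.WeightedFilteredSPA K A n) (L₀ : FilteredRes.FreeDatum)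
    (N : Submodule A (L₀.Mod A)) (L : FilteredRes.MinimalFilteredFreeResolution S L₀ N) :
    FilteredRes.IsMinimalGradedFreeResolution (𝒜 := FilteredRes.GrPiece S.F)
      (ℒ := fun i => FilteredRes.GrPiece ((L.obj i).fil S).F)
      (ℳ := FilteredRes.GrPiece ((L₀.fil S).quot N).F)
      (fun i => (L.filtered i).gr)
      (FilteredRes.isFilteredHom_mkQ (L₀.fil S) N).gr ∧
    FilteredRes.IsMinimalGradedFreeResolution (𝒜 := fun p => S.F p)
      (ℒ := fun i q => ((L.obj i).fil S).F q) (ℳ := fun q => ((L₀.fil S).quot N).F q)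
      (fun i => (L.filtered i).rees)
      (FilteredRes.isFilteredHom_mkQ (L₀.fil S) N).rees ∧
    ∀ L' : FilteredRes.MinimalFilteredFreeResolution S L₀ N,
      ∃ χ : ∀ i, (L.obj i).Mod A ≃ₗ[A] (L'.obj i).Mod A,
        χ 0 = LinearEquiv.refl A (L₀.Mod A) ∧
        (∀ i q, χ i '' (((L.obj i).fil S).F q : Set ((L.obj i).Mod A)) =
          (((L'.obj i).fil S).F q : Set ((L'.obj i).Mod A))) ∧
        ∀ i x, χ i (L.d i x) = L'.d i (χ (i + 1) x) := by
  refine ⟨?_, ?_, fun L' => L.exists_equiv L'⟩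
  · exact L.isMinimalGradedFreeResolution (t := true)
      (α := FilteredRes.grPresentation S.F)
      -- Compatibility holds by definition, since products of classes are computed on
      -- representatives.
      (fun i => FilteredRes.grPresentation _) (fun i p q a x => rfl)
      (FilteredRes.grPresentation _) (fun i => (L.filtered i).induces_gr)
      (FilteredRes.isFilteredHom_mkQ (L₀.fil S) N).induces_gr
  · exact L.isMinimalGradedFreeResolution (t := false)
      (α := FilteredRes.reesPresentation S.F)
      (fun i => FilteredRes.reesPresentation _) (fun i p q a x => rfl)
      (FilteredRes.reesPresentation _) (fun i => (L.filtered i).induces_rees)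
      (FilteredRes.isFilteredHom_mkQ (L₀.fil S) N).induces_rees
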